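/- Let $G$ be a compact real Lie group whose Lie algebra $\mathfrak{g}$ is semisimple (that is, has zero solvable radical), and let $\mathcal{D}:\mathfrak{g}\to\mathfrak{g}$ be any derivation of the Lie algebra $\mathfrak{g}$. Let $\mathcal{D}_{\mathbb{C}}$ denote the complexification of $\mathcal{D}$, acting on $\mathbb{C}\otimes_{\mathbb{R}}\mathfrak{g}$. Then: 1. Every eigenvalue $\mu\in\mathbb{C}$ of $\mathcal{D}_{\mathbb{C}}$ satisfies $\operatorname{Re}\mu=0$ and is semisimple, i.e. the generalized eigenspace of $\mathcal{D}_{\mathbb{C}}$ for $\mu$ equals the eigenspace of $\mathcal{D}_{\mathbb{C}}$ for $\mu$. 2. $\mathbb{C}\otimes_{\mathbb{R}}\mathfrak{g}$ has a basis consisting of eigenvectors of $\mathcal{D}_{\mathbb{C}}$, with eigenvalues in $i\mathbb{R}$. 3. In every Jordan basis of $\mathbb{C}\otimes_{\mathbb{R}}\mathfrak{g}$ for $\mathcal{D}_{\mathbb{C}}$, all Jordan blocks have size $1$. -/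

import Mathlib

open scoped Manifold ContDiff TensorProduct

/-- A smooth real Lie group is in particular smooth enough for its Lie algebra to be defined. -/
instance : ENat.LEInfty (minSmoothness ℝ 3) :=
  ⟨by rw [minSmoothness_of_isRCLikeNormedField]; exact ENat.LEInfty.out⟩

/-- The complexification of a real-linear endomorphism. Its eigenvalues and Jordan blocks are the
(complex) eigenvalues and complex Jordan blocks of the real endomorphism. -/
noncomputable abbrev complexify {V : Type*} [AddCommGroup V] [Module ℝ V] (T : V →ₗ[ℝ] V) :
    Module.End ℂ (ℂ ⊗[ℝ] V) :=
  LinearMap.baseChange ℂ T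

/-- `μ` is a semisimple eigenvalue of `T`: it is an eigenvalue, and its generalized eigenspace
consists of eigenvectors (together with zero). -/
def IsSemisimpleEigenvalue {W : Type*} [AddCommGroup W] [Module ℂ W]
    (T : Module.End ℂ W) (μ : ℂ) : Prop :=
  T.HasEigenvalue μ ∧ T.maxGenEigenspace μ = T.eigenspace μ

/-- `b` is a Jordan basis of `T` with `m` Jordan blocks, the `i`-th one having size `k i ≥ 1` and
eigenvalue `μ i`. -/
structure IsJordanBasis {W : Type*} [AddCommGroup W] [Module ℂ W] (T : Module.End ℂ W)
    {m : ℕ} (k : Fin m → ℕ) (μ : Fin m → ℂ)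
    (b : Module.Basis (Σ i : Fin m, Fin (k i)) ℂ W) : Prop where
  size_pos : ∀ i, 0 < k i
  apply_zero : ∀ (i : Fin m) (h : 0 < k i), T (b ⟨i, ⟨0, h⟩⟩) = μ i • b ⟨i, ⟨0, h⟩⟩
  apply_succ : ∀ (i : Fin m) (j : ℕ) (h : j + 1 < k i),
    T (b ⟨i, ⟨j + 1, h⟩⟩) = μ i • b ⟨i, ⟨j + 1, h⟩⟩ + b ⟨i, ⟨j, Nat.lt_of_succ_lt h⟩⟩

section SkewAdjoint

variable {V : Type*} [NormedAddCommGroup V] [InnerProductSpace ℝ V]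
  {T : V →ₗ[ℝ] V}

open scoped InnerProductSpace

theorem isSemisimple_of_skew [FiniteDimensional ℝ V] (hT : ∀ x y, ⟪T x, y⟫_ℝ = -⟪x, T y⟫_ℝ) :
    Module.End.IsSemisimple T := by
  rw [Module.End.isSemisimple_iff]
  intro p hp
  refine ⟨pᗮ, ?_, p.isCompl_orthogonal⟩
  intro x hx
  rw [Submodule.mem_comap, Submodule.mem_orthogonal]
  intro u hu
  have h := (Submodule.mem_orthogonal p x).1 hx (T u) (hp hu)
  rw [hT] at h
  linarith

theorem inner_apply_self_of_skew (hT : ∀ x y, ⟪T x, y⟫_ℝ = -⟪x, T y⟫_ℝ) (x : V) :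
    ⟪T x, x⟫_ℝ = 0 := by
  have h := hT x x
  rw [real_inner_comm (T x) x] at h
  linarith

theorem exists_re_im_of_complexification (w : ℂ ⊗[ℝ] V) :
    ∃ x y : V, w = (1 : ℂ) ⊗ₜ[ℝ] x + Complex.I ⊗ₜ[ℝ] y := by
  induction w with
  | zero => exact ⟨0, 0, by simp⟩
  | tmul z v =>
    refine ⟨z.re • v, z.im • v, ?_⟩
    rw [← TensorProduct.smul_tmul, ← TensorProduct.smul_tmul, ← TensorProduct.add_tmul]
    congr 1
    simp
  | add a b ha hb =>
    obtain ⟨x, y, rfl⟩ := ha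
    obtain ⟨x', y', rfl⟩ := hb
    refine ⟨x + x', y + y', ?_⟩
    rw [TensorProduct.tmul_add, TensorProduct.tmul_add]
    abel

theorem one_tmul_add_I_tmul_injective {x y x' y' : V}
    (h : (1 : ℂ) ⊗ₜ[ℝ] x + Complex.I ⊗ₜ[ℝ] y = (1 : ℂ) ⊗ₜ[ℝ] x' + Complex.I ⊗ₜ[ℝ] y') :
    x = x' ∧ y = y' := by
  constructor
  · have := congrArg (fun w => TensorProduct.lid ℝ V (Complex.reLm.rTensor V w)) h
    simpa using this
  · have := congrArg (fun w => TensorProduct.lid ℝ V (Complex.imLm.rTensor V w)) h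
    simpa using this

theorem re_eq_zero_of_hasEigenvalue_complexify (hT : ∀ x y, ⟪T x, y⟫_ℝ = -⟪x, T y⟫_ℝ) {μ : ℂ}
    (hμ : (complexify T).HasEigenvalue μ) : μ.re = 0 := by
  obtain ⟨w, hw⟩ := hμ.exists_hasEigenvector
  obtain ⟨x, y, rfl⟩ := exists_re_im_of_complexification w
  have h1 := hw.apply_eq_smul
  have h0 := hw.2
  have h2 : μ • ((1 : ℂ) ⊗ₜ[ℝ] x + Complex.I ⊗ₜ[ℝ] y) =
      (1 : ℂ) ⊗ₜ[ℝ] (μ.re • x - μ.im • y) + Complex.I ⊗ₜ[ℝ] (μ.im • x + μ.re • y) := by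
    simp only [TensorProduct.tmul_add, TensorProduct.tmul_sub, smul_add, TensorProduct.smul_tmul',
      ← TensorProduct.smul_tmul]
    have e1 : μ • (1 : ℂ) = μ.re • (1 : ℂ) + μ.im • Complex.I := by simp
    have e2 : μ • Complex.I = μ.re • Complex.I - μ.im • (1 : ℂ) := by simp [Complex.ext_iff]
    rw [e1, e2, TensorProduct.add_tmul, TensorProduct.sub_tmul]
    abel
  rw [h2] at h1
  simp only [complexify, map_add, LinearMap.baseChange_tmul] at h1
  obtain ⟨hx, hy⟩ := one_tmul_add_I_tmul_injective h1
  have ex := inner_apply_self_of_skew hT x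
  have ey := inner_apply_self_of_skew hT y
  rw [hx, inner_sub_left, real_inner_smul_left, real_inner_smul_left,
    real_inner_self_eq_norm_sq] at ex
  rw [hy, inner_add_left, real_inner_smul_left, real_inner_smul_left,
    real_inner_self_eq_norm_sq, real_inner_comm] at ey
  by_contra hre
  have hsum : μ.re * (‖x‖ ^ 2 + ‖y‖ ^ 2) = 0 := by linarith
  have hs := (mul_eq_zero.1 hsum).resolve_left hre
  have hx0 : x = 0 := by
    have : ‖x‖ ^ 2 = 0 := by nlinarith [sq_nonneg ‖x‖, sq_nonneg ‖y‖]
    simpa using this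
  have hy0 : y = 0 := by
    have : ‖y‖ ^ 2 = 0 := by nlinarith [sq_nonneg ‖x‖, sq_nonneg ‖y‖]
    simpa using this
  exact h0 (by simp [hx0, hy0])

end SkewAdjoint

section Semisimple

theorem isSemisimple_complexify {V : Type*} [AddCommGroup V] [Module ℝ V] [FiniteDimensional ℝ V]
    {T : Module.End ℝ V} (hT : T.IsSemisimple) : Module.End.IsSemisimple (complexify T) := by
  have hsq := hT.minpoly_squarefree
  have hsep : (minpoly ℝ T).Separable := PerfectField.separable_iff_squarefree.2 hsq
  refine Module.End.isSemisimple_of_squarefree_aeval_eq_zero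
    (p := (minpoly ℝ T).map (algebraMap ℝ ℂ)) (hsep.map).squarefree ?_
  rw [Polynomial.aeval_map_algebraMap]
  have : Polynomial.aeval (complexify T) (minpoly ℝ T) =
      Module.End.baseChangeHom ℝ ℂ V (Polynomial.aeval T (minpoly ℝ T)) := by
    rw [← Polynomial.aeval_algHom_apply]
    rfl
  rw [this, minpoly.aeval, map_zero]

variable {W : Type*} [AddCommGroup W] [Module ℂ W] {S : Module.End ℂ W}

theorem exists_basis_hasEigenvector_of_isSemisimple [FiniteDimensional ℂ W]
    (hS : S.IsSemisimple) :
    ∃ (n : ℕ) (b : Module.Basis (Fin n) ℂ W) (μ : Fin n → ℂ), ∀ i, S.HasEigenvector (μ i) (b i) := by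
  let s : Set W := {w | ∃ μ, S.HasEigenvector μ w}
  have hs : Submodule.span ℂ s = ⊤ := by
    rw [eq_top_iff, ← Module.End.iSup_maxGenEigenspace_eq_top S]
    refine iSup_le fun μ => ?_
    rw [hS.isFinitelySemisimple.maxGenEigenspace_eq_eigenspace]
    intro w hw
    by_cases h0 : w = 0
    · rw [h0]; exact zero_mem _
    · exact Submodule.subset_span ⟨μ, hw, h0⟩
  let b := Module.Basis.ofSpan hs.ge
  have hb : ∀ i, ∃ μ, S.HasEigenvector μ (b i) := fun i =>
    Module.Basis.ofSpan_subset hs.ge ⟨i, rfl⟩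
  choose μ hμ using hb
  have := Module.Finite.finite_basis b
  obtain ⟨n, ⟨e⟩⟩ := Finite.exists_equiv_fin
    ((linearIndepOn_empty ℂ (_root_.id : W → W)).extend (Set.empty_subset s))
  exact ⟨n, b.reindex e, fun i => μ (e.symm i), fun i => by
    rw [Module.Basis.reindex_apply]; exact hμ _⟩

theorem IsJordanBasis.size_eq_one_of_isSemisimple (hS : S.IsSemisimple) {m : ℕ} {k : Fin m → ℕ}
    {μ : Fin m → ℂ} {b : Module.Basis (Σ i : Fin m, Fin (k i)) ℂ W} (hb : IsJordanBasis S k μ b)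
    (i : Fin m) : k i = 1 := by
  by_contra hne
  have h0 := hb.size_pos i
  have h1 : 0 + 1 < k i := by omega
  have e0 := hb.apply_zero i h0
  have e1 := hb.apply_succ i 0 h1
  have hmem : b ⟨i, ⟨0 + 1, h1⟩⟩ ∈ S.maxGenEigenspace (μ i) := by
    rw [Module.End.mem_maxGenEigenspace]
    refine ⟨2, ?_⟩
    rw [pow_two, Module.End.mul_apply]
    simp [e1, e0]
  rw [hS.isFinitelySemisimple.maxGenEigenspace_eq_eigenspace, Module.End.mem_eigenspace_iff,
    e1] at hmem
  exact b.ne_zero _ (by simpa using hmem)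

end Semisimple

section LieAlgebra

variable {L : Type*} [LieRing L] [LieAlgebra ℝ L] [FiniteDimensional ℝ L]

theorem derivation_spectral_of_posDef_invariant [LieAlgebra.HasTrivialRadical ℝ L]
    (c : InnerProductSpace.Core ℝ L)
    (hc : ∀ z x y : L, c.inner ⁅z, x⁆ y = -c.inner x ⁅z, y⁆) (D : LieDerivation ℝ L L) :
    (complexify D.toLinearMap).IsSemisimple ∧
      ∀ μ, (complexify D.toLinearMap).HasEigenvalue μ → μ.re = 0 := by
  have : LieAlgebra.IsKilling ℝ L := inferInstance
  obtain ⟨z, rfl⟩ := LieDerivation.IsKilling.exists_eq_ad D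
  let : NormedAddCommGroup L := c.toNormedAddCommGroup
  let : InnerProductSpace ℝ L := InnerProductSpace.ofCore c.toCore
  have hskew : ∀ x y, inner ℝ ((LieDerivation.ad ℝ L z).toLinearMap x) y =
      -inner ℝ x ((LieDerivation.ad ℝ L z).toLinearMap y) := fun x y => by
    have h1 : ∀ w, (LieDerivation.ad ℝ L z).toLinearMap w = ⁅z, w⁆ := fun w => by simp
    rw [h1, h1]
    exact hc z x y
  exact ⟨isSemisimple_complexify (isSemisimple_of_skew hskew), fun μ hμ =>
    re_eq_zero_of_hasEigenvalue_complexify hskew hμ⟩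

end LieAlgebra

section AdjointRepresentation

open scoped Topology
open VectorField

variable {E : Type*} [NormedAddCommGroup E] [NormedSpace ℝ E]
  {H : Type*} [TopologicalSpace H] (I : ModelWithCorners ℝ E H)
  {G : Type*} [Group G] [TopologicalSpace G] [ChartedSpace H G]

/-- Conjugation by `g`, read in the preferred chart at the identity. -/
noncomputable def chartConj (g : G) (z : E) : E :=
  extChartAt I (1 : G) (g * (extChartAt I (1 : G)).symm z * g⁻¹)

/-- The multiplication, read in the preferred chart at the identity. -/
noncomputable def chartMul (G : Type*) [Group G] [TopologicalSpace G] [ChartedSpace H G]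
    (p : E × E) : E :=
  extChartAt I (1 : G) ((extChartAt I (1 : G)).symm p.1 * (extChartAt I (1 : G)).symm p.2)

/-- The adjoint action of `g` on the Lie algebra, read in the preferred chart at the identity. -/
noncomputable def adjointAction (g : G) : E →L[ℝ] E :=
  fderiv ℝ (chartConj I g) (extChartAt I (1 : G) 1)

theorem chartConj_apply_one (g : G) :
    chartConj I g (extChartAt I (1 : G) 1) = extChartAt I (1 : G) 1 := by
  simp [chartConj]

theorem chartMul_one_right {y : E} (hy : y ∈ (extChartAt I (1 : G)).target) :
    chartMul I G (y, extChartAt I (1 : G) 1) = y := by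
  simpa [chartMul] using (extChartAt I (1 : G)).right_inv hy

theorem chartMul_one_left {y : E} (hy : y ∈ (extChartAt I (1 : G)).target) :
    chartMul I G (extChartAt I (1 : G) 1, y) = y := by
  simpa [chartMul] using (extChartAt I (1 : G)).right_inv hy

variable [I.Boundaryless] [LieGroup I ∞ G]

theorem contMDiffAt_extChartAt_symm_one :
    ContMDiffAt 𝓘(ℝ, E) I ∞ (extChartAt I (1 : G)).symm (extChartAt I (1 : G) 1) :=
  (contMDiffOn_extChartAt_symm (1 : G)).contMDiffAt (extChartAt_target_mem_nhds (1 : G))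

theorem contMDiffAt_chartConj (g : G) :
    ContMDiffAt (I.prod 𝓘(ℝ, E)) 𝓘(ℝ, E) ∞ (Function.uncurry (chartConj (G := G) I))
      (g, extChartAt I (1 : G) 1) := by
  have h1 : ContMDiffAt (I.prod 𝓘(ℝ, E)) I ∞
      (fun p : G × E => p.1 * (extChartAt I (1 : G)).symm p.2 * p.1⁻¹)
      (g, extChartAt I (1 : G) 1) := by
    refine (contMDiffAt_fst.mul ?_).mul contMDiffAt_fst.inv
    exact ContMDiffAt.comp (g, extChartAt I (1 : G) 1) (contMDiffAt_extChartAt_symm_one I)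
      contMDiffAt_snd
  have h2 : ContMDiffAt I 𝓘(ℝ, E) ∞ (extChartAt I (1 : G))
      ((fun p : G × E => p.1 * (extChartAt I (1 : G)).symm p.2 * p.1⁻¹)
        (g, extChartAt I (1 : G) 1)) := by
    simpa using contMDiffAt_extChartAt (I := I) (x := (1 : G))
  exact ContMDiffAt.comp (g, extChartAt I (1 : G) 1) h2 h1

theorem contDiffAt_chartMul :
    ContDiffAt ℝ ∞ (chartMul I G) (extChartAt I (1 : G) 1, extChartAt I (1 : G) 1) := by
  rw [← contMDiffAt_iff_contDiffAt]
  have h1 : ContMDiffAt 𝓘(ℝ, E × E) I ∞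
      (fun p : E × E => (extChartAt I (1 : G)).symm p.1 * (extChartAt I (1 : G)).symm p.2)
      (extChartAt I (1 : G) 1, extChartAt I (1 : G) 1) :=
    (ContMDiffAt.comp (extChartAt I (1 : G) 1, extChartAt I (1 : G) 1)
      (contMDiffAt_extChartAt_symm_one I) contDiffAt_fst.contMDiffAt).mul
    (ContMDiffAt.comp (extChartAt I (1 : G) 1, extChartAt I (1 : G) 1)
      (contMDiffAt_extChartAt_symm_one I) contDiffAt_snd.contMDiffAt)
  have h2 : ContMDiffAt I 𝓘(ℝ, E) ∞ (extChartAt I (1 : G))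
      ((fun p : E × E => (extChartAt I (1 : G)).symm p.1 * (extChartAt I (1 : G)).symm p.2)
        (extChartAt I (1 : G) 1, extChartAt I (1 : G) 1)) := by
    simpa using contMDiffAt_extChartAt (I := I) (x := (1 : G))
  exact ContMDiffAt.comp (extChartAt I (1 : G) 1, extChartAt I (1 : G) 1) h2 h1

theorem contMDiff_adjointAction :
    ContMDiff I 𝓘(ℝ, E →L[ℝ] E) ∞ (adjointAction (G := G) I) := by
  intro g
  have h := ContMDiffAt.mfderiv (chartConj (G := G) I) (fun _ => extChartAt I (1 : G) 1)
    (contMDiffAt_chartConj I g) (contMDiffAt_const (n := ∞)) (le_of_eq rfl)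
  have e := inTangentCoordinates_model_space (I := 𝓘(ℝ, E)) (I' := 𝓘(ℝ, E))
    (fun _ : G => extChartAt I (1 : G) 1) (fun x : G => chartConj I x (extChartAt I (1 : G) 1))
    (adjointAction I) g
  simp only [mfderiv_eq_fderiv] at h
  exact (congrArg (fun f => ContMDiffAt I 𝓘(ℝ, E →L[ℝ] E) ∞ f g) e).mp h

theorem differentiableAt_chartConj (g : G) :
    DifferentiableAt ℝ (chartConj I g) (extChartAt I (1 : G) 1) := by
  have h : ContMDiffAt 𝓘(ℝ, E) 𝓘(ℝ, E) ∞ (chartConj I g) (extChartAt I (1 : G) 1) :=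
    ContMDiffAt.comp (g := Function.uncurry (chartConj (G := G) I)) (f := fun z => (g, z))
      (extChartAt I (1 : G) 1) (contMDiffAt_chartConj I g)
      (contMDiffAt_const.prodMk contMDiffAt_id)
  exact h.contDiffAt.differentiableAt (by simp)

theorem eventually_extChartAt_symm_chartConj (g : G) :
    ∀ᶠ z in 𝓝 (extChartAt I (1 : G) 1),
      (extChartAt I (1 : G)).symm (chartConj I g z) = g * (extChartAt I (1 : G)).symm z * g⁻¹ := by
  have hc : ContinuousAt (fun z => g * (extChartAt I (1 : G)).symm z * g⁻¹)
      (extChartAt I (1 : G) 1) :=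
    ((contMDiffAt_const.mul (contMDiffAt_extChartAt_symm_one I)).mul
      (contMDiffAt_const (c := g⁻¹))).continuousAt (n := ∞) (I' := I)
  have hs : (extChartAt I (1 : G)).source ∈
      𝓝 (g * (extChartAt I (1 : G)).symm (extChartAt I (1 : G) 1) * g⁻¹) := by
    simpa using extChartAt_source_mem_nhds (I := I) (1 : G)
  filter_upwards [hc hs] with z hz
  exact (extChartAt I (1 : G)).left_inv hz

theorem adjointAction_mul (g h : G) :
    adjointAction I (g * h) = (adjointAction I g).comp (adjointAction I h) := by
  have hev : chartConj I (g * h) =ᶠ[𝓝 (extChartAt I (1 : G) 1)]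
      chartConj I g ∘ chartConj I h := by
    filter_upwards [eventually_extChartAt_symm_chartConj I h] with z hz
    rw [Function.comp_apply, chartConj, chartConj, hz]
    simp only [mul_assoc, mul_inv_rev]
  rw [adjointAction, hev.fderiv_eq, fderiv_comp]
  · rw [chartConj_apply_one]; rfl
  · rw [chartConj_apply_one]; exact differentiableAt_chartConj I g
  · exact differentiableAt_chartConj I h

omit [LieGroup I ∞ G] in
theorem adjointAction_one : adjointAction I (1 : G) = ContinuousLinearMap.id ℝ E := by
  have hev : chartConj I (1 : G) =ᶠ[𝓝 (extChartAt I (1 : G) 1)] id := by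
    filter_upwards [extChartAt_target_mem_nhds (I := I) (1 : G)] with z hz
    simpa [chartConj] using (extChartAt I (1 : G)).right_inv hz
  rw [adjointAction, hev.fderiv_eq, fderiv_id]

end AdjointRepresentation

section BracketInChart

open scoped Topology
open VectorField

variable {E : Type*} [NormedAddCommGroup E] [NormedSpace ℝ E]
  {H : Type*} [TopologicalSpace H] (I : ModelWithCorners ℝ E H) [I.Boundaryless]
  {G : Type*} [Group G] [TopologicalSpace G] [ChartedSpace H G] [LieGroup I ∞ G]

theorem mpullbackWithin_mulInvariantVectorField (X : GroupLieAlgebra I G) {y : E}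
    (hy : y ∈ (extChartAt I (1 : G)).target) :
    mpullbackWithin 𝓘(ℝ, E) I (extChartAt I (1 : G)).symm (mulInvariantVectorField X)
        (Set.range I) y =
      fderiv ℝ (fun z => chartMul I G (y, z)) (extChartAt I (1 : G) 1) X := by
  set g := (extChartAt I (1 : G)).symm y with hg
  have : IsManifold I 1 G := inferInstance
  have hgs : g ∈ (extChartAt I (1 : G)).source := (extChartAt I (1 : G)).map_target hy
  have hinv : (mfderivWithin 𝓘(ℝ, E) I (extChartAt I (1 : G)).symm (Set.range I) y).inverse =
      mfderiv I 𝓘(ℝ, E) (extChartAt I (1 : G)) g :=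
    ContinuousLinearMap.inverse_eq (mfderivWithin_extChartAt_symm_comp_mfderiv_extChartAt hy)
      (mfderiv_extChartAt_comp_mfderivWithin_extChartAt_symm hy)
  have hmul : MDifferentiableAt I I (fun x : G => g * x) 1 :=
    (contMDiff_mul_left (I := I) (n := ∞)).contMDiffAt.mdifferentiableAt (by simp)
  have hchart : MDifferentiableAt I 𝓘(ℝ, E) (extChartAt I (1 : G)) g :=
    mdifferentiableAt_extChartAt (by simpa using hgs)
  have hcomp := mfderiv_comp_of_eq (x := (1 : G)) (f := fun x : G => g * x) hchart hmul (mul_one g)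
  have hval : mfderiv I 𝓘(ℝ, E) (extChartAt I (1 : G) ∘ fun x : G => g * x) 1 =
      fderiv ℝ (fun z => chartMul I G (y, z)) (extChartAt I (1 : G) 1) := by
    rw [MDifferentiableAt.mfderiv
      (hchart.comp_of_eq (f := fun x : G => g * x) (x := (1 : G)) hmul (mul_one g))]
    simp [writtenInExtChartAt, I.range_eq_univ, fderivWithin_univ]
    rfl
  rw [mpullbackWithin_apply, hinv, ← hval, hcomp]
  have e : ∀ h : G, h = g → ∀ v : E, (mfderiv I 𝓘(ℝ, E) (extChartAt I (1 : G)) h : E →L[ℝ] E) v =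
      (mfderiv I 𝓘(ℝ, E) (extChartAt I (1 : G)) g : E →L[ℝ] E) v := by
    rintro _ rfl v
    rfl
  exact (e _ (mul_one g) _).symm

theorem groupLieAlgebra_bracket_eq (Z X : GroupLieAlgebra I G) :
    ⁅Z, X⁆ =
      fderiv ℝ (fun y => fderiv ℝ (fun z => chartMul I G (y, z)) (extChartAt I (1 : G) 1) X)
          (extChartAt I (1 : G) 1) Z -
        fderiv ℝ (fun y => fderiv ℝ (fun z => chartMul I G (y, z)) (extChartAt I (1 : G) 1) Z)
          (extChartAt I (1 : G) 1) X := by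
  have hev : ∀ W : GroupLieAlgebra I G,
      mpullbackWithin 𝓘(ℝ, E) I (extChartAt I (1 : G)).symm (mulInvariantVectorField W)
        (Set.range I) =ᶠ[𝓝 (extChartAt I (1 : G) 1)]
      fun y => fderiv ℝ (fun z => chartMul I G (y, z)) (extChartAt I (1 : G) 1) W := by
    intro W
    filter_upwards [extChartAt_target_mem_nhds (I := I) (1 : G)] with y hy
    exact mpullbackWithin_mulInvariantVectorField I W hy
  have hid : fderiv ℝ (fun z => chartMul I G (extChartAt I (1 : G) 1, z))
      (extChartAt I (1 : G) 1) = ContinuousLinearMap.id ℝ E := by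
    have : (fun z => chartMul I G (extChartAt I (1 : G) 1, z)) =ᶠ[𝓝 (extChartAt I (1 : G) 1)]
        id := by
      filter_upwards [extChartAt_target_mem_nhds (I := I) (1 : G)] with y hy
      exact chartMul_one_left I hy
    rw [this.fderiv_eq, fderiv_id]
  have : IsManifold I 1 G := inferInstance
  have hinv : ∀ v : E,
      (mfderiv I 𝓘(ℝ, E) (extChartAt I (1 : G)) (1 : G) : E →L[ℝ] E).inverse v = v := by
    intro v
    have h : (mfderiv I 𝓘(ℝ, E) (extChartAt I (1 : G)) (1 : G) : E →L[ℝ] E) =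
      ContinuousLinearMap.id ℝ E := mfderiv_extChartAt_self
    refine (congrArg (fun A : E →L[ℝ] E => A.inverse v) h).trans ?_
    simp only [ContinuousLinearMap.inverse_id, ContinuousLinearMap.id_apply]
  rw [GroupLieAlgebra.bracket_def, mlieBracket, mlieBracketWithin_apply]
  refine (hinv _).trans ?_
  have huniv : (extChartAt I (1 : G)).symm ⁻¹' Set.univ ∩ Set.range I = Set.univ := by
    rw [I.range_eq_univ]; simp
  have key : ∀ V W V' W' : E → E, V =ᶠ[𝓝 (extChartAt I (1 : G) 1)] V' →
      W =ᶠ[𝓝 (extChartAt I (1 : G) 1)] W' →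
      lieBracketWithin ℝ V W ((extChartAt I (1 : G)).symm ⁻¹' Set.univ ∩ Set.range I)
        (extChartAt I (1 : G) 1) =
      fderiv ℝ W' (extChartAt I (1 : G) 1) (V' (extChartAt I (1 : G) 1)) -
        fderiv ℝ V' (extChartAt I (1 : G) 1) (W' (extChartAt I (1 : G) 1)) := by
    intro V W V' W' hV hW
    rw [huniv, lieBracketWithin_univ, hV.lieBracket_vectorField_eq hW, lieBracket]
  refine (key _ _ _ _ (hev Z) (hev X)).trans ?_
  simp only [hid]
  rfl

end BracketInChart

section PartialDerivatives

open scoped Topology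

variable {E F : Type*} [NormedAddCommGroup E] [NormedSpace ℝ E] [NormedAddCommGroup F]
  [NormedSpace ℝ F] {M : E × E → F} {a b : E}

theorem ContDiffAt.eventually_hasFDerivAt_prod_left (hM : ContDiffAt ℝ 2 M (a, b)) :
    ∀ᶠ y in 𝓝 b, HasFDerivAt (fun z => M (z, y))
      ((fderiv ℝ M (a, y)).comp (ContinuousLinearMap.inl ℝ E E)) a := by
  have hc : ContinuousAt (fun y : E => (a, y)) b := by fun_prop
  have h := hc.eventually (hM.eventually (by simp))
  filter_upwards [h] with y hy
  exact (hy.differentiableAt (by simp)).hasFDerivAt.comp a (hasFDerivAt_prodMk_left a y)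

theorem ContDiffAt.eventually_hasFDerivAt_prod_right (hM : ContDiffAt ℝ 2 M (a, b)) :
    ∀ᶠ y in 𝓝 a, HasFDerivAt (fun z => M (y, z))
      ((fderiv ℝ M (y, b)).comp (ContinuousLinearMap.inr ℝ E E)) b := by
  have hc : ContinuousAt (fun y : E => (y, b)) a := by fun_prop
  have h := hc.eventually (hM.eventually (by simp))
  filter_upwards [h] with y hy
  exact (hy.differentiableAt (by simp)).hasFDerivAt.comp b (hasFDerivAt_prodMk_right y b)

theorem ContDiffAt.hasFDerivAt_fderiv_prod_left (hM : ContDiffAt ℝ 2 M (a, b)) :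
    HasFDerivAt (fun y => fderiv ℝ (fun z => M (z, y)) a)
      (((ContinuousLinearMap.compL ℝ E (E × E) F).flip (ContinuousLinearMap.inl ℝ E E)).comp
        ((fderiv ℝ (fderiv ℝ M) (a, b)).comp (ContinuousLinearMap.inr ℝ E E))) b := by
  have h2 : HasFDerivAt (fderiv ℝ M) (fderiv ℝ (fderiv ℝ M) (a, b)) (a, b) :=
    ((hM.fderiv_right (m := 1) (by norm_num)).differentiableAt (by simp)).hasFDerivAt
  have h3 := (ContinuousLinearMap.hasFDerivAt _).comp b
    (h2.comp b (hasFDerivAt_prodMk_right a b))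
    (g := (ContinuousLinearMap.compL ℝ E (E × E) F).flip (ContinuousLinearMap.inl ℝ E E))
  refine h3.congr_of_eventuallyEq ?_
  filter_upwards [hM.eventually_hasFDerivAt_prod_left] with y hy
  exact hy.fderiv

theorem ContDiffAt.hasFDerivAt_fderiv_prod_right (hM : ContDiffAt ℝ 2 M (a, b)) :
    HasFDerivAt (fun y => fderiv ℝ (fun z => M (y, z)) b)
      (((ContinuousLinearMap.compL ℝ E (E × E) F).flip (ContinuousLinearMap.inr ℝ E E)).comp
        ((fderiv ℝ (fderiv ℝ M) (a, b)).comp (ContinuousLinearMap.inl ℝ E E))) a := by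
  have h2 : HasFDerivAt (fderiv ℝ M) (fderiv ℝ (fderiv ℝ M) (a, b)) (a, b) :=
    ((hM.fderiv_right (m := 1) (by norm_num)).differentiableAt (by simp)).hasFDerivAt
  have h3 := (ContinuousLinearMap.hasFDerivAt _).comp a
    (h2.comp a (hasFDerivAt_prodMk_left a b))
    (g := (ContinuousLinearMap.compL ℝ E (E × E) F).flip (ContinuousLinearMap.inr ℝ E E))
  refine h3.congr_of_eventuallyEq ?_
  filter_upwards [hM.eventually_hasFDerivAt_prod_right] with y hy
  exact hy.fderiv

/-- The mixed second partial derivatives agree. -/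
theorem ContDiffAt.fderiv_fderiv_prod_comm (hM : ContDiffAt ℝ 2 M (a, b)) (u v : E) :
    fderiv ℝ (fun y => fderiv ℝ (fun z => M (z, y)) a) b u v =
      fderiv ℝ (fun y => fderiv ℝ (fun z => M (y, z)) b) a v u := by
  rw [hM.hasFDerivAt_fderiv_prod_left.fderiv, hM.hasFDerivAt_fderiv_prod_right.fderiv]
  exact (hM.isSymmSndFDerivAt (by simp)).eq _ _

end PartialDerivatives

section AdjointDerivative

open scoped Topology

variable {E : Type*} [NormedAddCommGroup E] [NormedSpace ℝ E]
  {H : Type*} [TopologicalSpace H] (I : ModelWithCorners ℝ E H) [I.Boundaryless]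
  {G : Type*} [Group G] [TopologicalSpace G] [ChartedSpace H G] [LieGroup I ∞ G]

theorem differentiableAt_adjointAction_comp_extChartAt_symm :
    DifferentiableAt ℝ (fun y => adjointAction I ((extChartAt I (1 : G)).symm y))
      (extChartAt I (1 : G) 1) := by
  have h : ContMDiffAt 𝓘(ℝ, E) 𝓘(ℝ, E →L[ℝ] E) ∞
      (fun y => adjointAction I ((extChartAt I (1 : G)).symm y)) (extChartAt I (1 : G) 1) :=
    (contMDiff_adjointAction (G := G) I).contMDiffAt.comp _ (contMDiffAt_extChartAt_symm_one I)
  exact h.contDiffAt.differentiableAt (by simp)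

/-- Left translation is right translation after conjugation, at the level of derivatives. -/
theorem eventually_fderiv_chartMul_eq_comp_adjointAction :
    ∀ᶠ y in 𝓝 (extChartAt I (1 : G) 1),
      fderiv ℝ (fun z => chartMul I G (y, z)) (extChartAt I (1 : G) 1) =
        (fderiv ℝ (fun z => chartMul I G (z, y)) (extChartAt I (1 : G) 1)).comp
          (adjointAction I ((extChartAt I (1 : G)).symm y)) := by
  have hM : ContDiffAt ℝ 2 (chartMul I G) (extChartAt I (1 : G) 1, extChartAt I (1 : G) 1) :=
    (contDiffAt_chartMul I).of_le ENat.LEInfty.out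
  filter_upwards [hM.eventually_hasFDerivAt_prod_left] with y hy
  set g := (extChartAt I (1 : G)).symm y with hg
  have hev : (fun z => chartMul I G (y, z)) =ᶠ[𝓝 (extChartAt I (1 : G) 1)]
      (fun w => chartMul I G (w, y)) ∘ chartConj I g := by
    filter_upwards [eventually_extChartAt_symm_chartConj I g] with z hz
    simp only [Function.comp_apply, chartMul, hz, ← hg, inv_mul_cancel_right]
  rw [hev.fderiv_eq, fderiv_comp _ _ (differentiableAt_chartConj I g), chartConj_apply_one]
  · rfl
  · rw [chartConj_apply_one]
    exact hy.differentiableAt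

theorem fderiv_adjointAction (Z X : GroupLieAlgebra I G) :
    fderiv ℝ (fun y => adjointAction I ((extChartAt I (1 : G)).symm y)) (extChartAt I (1 : G) 1)
      Z X = ⁅Z, X⁆ := by
  set e := extChartAt I (1 : G) 1 with he
  have hM : ContDiffAt ℝ 2 (chartMul I G) (e, e) :=
    (contDiffAt_chartMul I).of_le ENat.LEInfty.out
  have hL := hM.hasFDerivAt_fderiv_prod_right.differentiableAt.hasFDerivAt
  have hR := hM.hasFDerivAt_fderiv_prod_left.differentiableAt.hasFDerivAt
  have hA := (differentiableAt_adjointAction_comp_extChartAt_symm (G := G) I).hasFDerivAt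
  have hid : fderiv ℝ (fun z => chartMul I G (z, e)) e = ContinuousLinearMap.id ℝ E := by
    have : (fun z => chartMul I G (z, e)) =ᶠ[𝓝 e] id := by
      filter_upwards [extChartAt_target_mem_nhds (I := I) (1 : G)] with y hy
      exact chartMul_one_right I hy
    rw [this.fderiv_eq, fderiv_id]
  have hA1 : adjointAction I ((extChartAt I (1 : G)).symm e) = ContinuousLinearMap.id ℝ E := by
    rw [he, extChartAt_to_inv, adjointAction_one]
  have hev : (fun y => (fderiv ℝ (fun z => chartMul I G (z, y)) e).comp
      (adjointAction I ((extChartAt I (1 : G)).symm y))) =ᶠ[𝓝 e]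
      fun y => fderiv ℝ (fun z => chartMul I G (y, z)) e :=
    (eventually_fderiv_chartMul_eq_comp_adjointAction I).mono fun _ h => h.symm
  have hLR := ((hR.clm_comp hA).congr_of_eventuallyEq hev.symm).unique hL
  have h := congrArg (fun T : E →L[ℝ] E →L[ℝ] E => T Z X) hLR
  simp only [hid, hA1] at h
  have hcomm := hM.fderiv_fderiv_prod_comm Z X
  have happ : ∀ U V : E, fderiv ℝ (fun y => fderiv ℝ (fun z => chartMul I G (y, z)) e U) e V =
      fderiv ℝ (fun y => fderiv ℝ (fun z => chartMul I G (y, z)) e) e V U := by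
    intro U V
    rw [(hL.clm_apply (hasFDerivAt_const U e)).fderiv]
    simp
  rw [groupLieAlgebra_bracket_eq]
  refine Eq.trans ?_ (congrArg₂ (fun u v : E => u - v) (happ X Z) (happ Z X)).symm
  rw [← hcomm, ← h]
  exact (add_sub_cancel_right _ _).symm

end AdjointDerivative

section InvariantInnerProduct

open scoped Topology
open MeasureTheory

variable {E : Type*} [NormedAddCommGroup E] [NormedSpace ℝ E] [FiniteDimensional ℝ E]
  {H : Type*} [TopologicalSpace H] (I : ModelWithCorners ℝ E H) [I.Boundaryless]
  {G : Type*} [Group G] [TopologicalSpace G] [ChartedSpace H G] [LieGroup I ∞ G]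

/-- The Euclidean inner product of two vectors, after both are moved by `g⁻¹`. -/
noncomputable def translatedInner (X Y : E) (g : G) : ℝ :=
  inner ℝ (toEuclidean (adjointAction I g⁻¹ X)) (toEuclidean (adjointAction I g⁻¹ Y))

theorem continuous_translatedInner (X Y : E) :
    Continuous (translatedInner (G := G) I X Y) := by
  have : IsTopologicalGroup G := topologicalGroup_of_lieGroup I ∞
  have hA : Continuous fun g : G => adjointAction I g⁻¹ :=
    (contMDiff_adjointAction (G := G) I).continuous.comp continuous_inv
  exact (toEuclidean.continuous.comp (hA.clm_apply continuous_const)).inner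
    (toEuclidean.continuous.comp (hA.clm_apply continuous_const))

theorem translatedInner_adjointAction (h : G) (X Y : E) (g : G) :
    translatedInner I (adjointAction I h X) (adjointAction I h Y) g =
      translatedInner I X Y (h⁻¹ * g) := by
  simp only [translatedInner, mul_inv_rev, inv_inv, adjointAction_mul,
    ContinuousLinearMap.comp_apply]

variable [CompactSpace G]

variable (G) in
/-- The Haar average of the translated inner products. -/
noncomputable def averagedInner (X Y : E) : ℝ :=
  letI : MeasurableSpace G := borel G
  haveI : BorelSpace G := ⟨rfl⟩
  haveI : IsTopologicalGroup G := topologicalGroup_of_lieGroup I ∞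
  ∫ g, translatedInner (G := G) I X Y g ∂Measure.haar

theorem averagedInner_adjointAction (h : G) (X Y : E) :
    averagedInner I G (adjointAction I h X) (adjointAction I h Y) = averagedInner I G X Y := by
  let : MeasurableSpace G := borel G
  have : BorelSpace G := ⟨rfl⟩
  have : IsTopologicalGroup G := topologicalGroup_of_lieGroup I ∞
  simp only [averagedInner, translatedInner_adjointAction]
  exact integral_mul_left_eq_self _ h⁻¹

omit [I.Boundaryless] in
theorem averagedInner_comm (X Y : E) : averagedInner I G X Y = averagedInner I G Y X := by
  simp only [averagedInner, translatedInner, real_inner_comm]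

theorem averagedInner_add_left (X X' Y : E) :
    averagedInner I G (X + X') Y = averagedInner I G X Y + averagedInner I G X' Y := by
  let : MeasurableSpace G := borel G
  have : BorelSpace G := ⟨rfl⟩
  have : IsTopologicalGroup G := topologicalGroup_of_lieGroup I ∞
  have hint : ∀ U V : E, Integrable (translatedInner (G := G) I U V) Measure.haar := fun U V =>
    (continuous_translatedInner I U V).integrable_of_hasCompactSupport
      (HasCompactSupport.of_compactSpace _)
  refine Eq.trans ?_ (integral_add (hint X Y) (hint X' Y))
  simp only [averagedInner, translatedInner, map_add, inner_add_left]

omit [I.Boundaryless] in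
theorem averagedInner_smul_left (r : ℝ) (X Y : E) :
    averagedInner I G (r • X) Y = r * averagedInner I G X Y := by
  let : MeasurableSpace G := borel G
  have : BorelSpace G := ⟨rfl⟩
  have : IsTopologicalGroup G := topologicalGroup_of_lieGroup I ∞
  refine Eq.trans ?_ (integral_const_mul r _)
  simp only [averagedInner, translatedInner, map_smul, real_inner_smul_left]

omit [I.Boundaryless] in
theorem averagedInner_self_nonneg (X : E) : 0 ≤ averagedInner I G X X :=
  integral_nonneg fun _ => real_inner_self_nonneg

theorem eq_zero_of_averagedInner_self {X : E} (hX : averagedInner I G X X = 0) : X = 0 := by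
  let : MeasurableSpace G := borel G
  have : BorelSpace G := ⟨rfl⟩
  have : IsTopologicalGroup G := topologicalGroup_of_lieGroup I ∞
  by_contra hne
  have hpos := Continuous.integral_pos_of_hasCompactSupport_nonneg_nonzero
    (continuous_translatedInner (G := G) I X X) (μ := Measure.haar) (HasCompactSupport.of_compactSpace _)
    (fun _ => real_inner_self_nonneg) (x := 1) (by
      simpa [translatedInner, adjointAction_one] using hne)
  exact hpos.ne' hX

variable (G) in
/-- The inner product on the Lie algebra of a compact Lie group obtained by averaging. -/
@[reducible] noncomputable def averagedCore : InnerProductSpace.Core ℝ (GroupLieAlgebra I G) where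
  inner X Y := averagedInner I G X Y
  conj_inner_symm X Y := averagedInner_comm I Y X
  re_inner_nonneg X := averagedInner_self_nonneg I X
  add_left X X' Y := averagedInner_add_left I X X' Y
  smul_left X Y r := averagedInner_smul_left I r X Y
  definite _ hX := eq_zero_of_averagedInner_self I hX

theorem averagedInner_bracket (Z X Y : GroupLieAlgebra I G) :
    averagedInner I G (⁅Z, X⁆ : GroupLieAlgebra I G) Y =
      -averagedInner I G X (⁅Z, Y⁆ : GroupLieAlgebra I G) := by
  let B : E →ₗ[ℝ] E →ₗ[ℝ] ℝ := LinearMap.mk₂ ℝ (averagedInner I G)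
    (averagedInner_add_left I) (averagedInner_smul_left I)
    (fun X Y Y' => by
      rw [averagedInner_comm, averagedInner_add_left, averagedInner_comm I Y,
        averagedInner_comm I Y'])
    (fun r X Y => by
      rw [averagedInner_comm, averagedInner_smul_left, averagedInner_comm I Y, smul_eq_mul])
  set e := extChartAt I (1 : G) 1 with he
  have hA := (differentiableAt_adjointAction_comp_extChartAt_symm (G := G) I).hasFDerivAt
  have happ : ∀ W : E, HasFDerivAt (fun y => adjointAction I ((extChartAt I (1 : G)).symm y) W)
      ((fderiv ℝ (fun y => adjointAction I ((extChartAt I (1 : G)).symm y)) e).flip W) e := by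
    intro W
    refine (hA.clm_apply (hasFDerivAt_const W e)).congr_fderiv ?_
    ext; simp [he]
  have hA1 : adjointAction I ((extChartAt I (1 : G)).symm e) = ContinuousLinearMap.id ℝ E := by
    rw [he, extChartAt_to_inv, adjointAction_one]
  have hB := B.toContinuousBilinearMap.hasFDerivAt_of_bilinear (happ X) (happ Y)
  have hconst : HasFDerivAt (fun y =>
      B.toContinuousBilinearMap (adjointAction I ((extChartAt I (1 : G)).symm y) X)
        (adjointAction I ((extChartAt I (1 : G)).symm y) Y)) (0 : E →L[ℝ] ℝ) e := by
    refine (hasFDerivAt_const (averagedInner I G X Y) e).congr_of_eventuallyEq ?_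
    exact Filter.Eventually.of_forall fun y => averagedInner_adjointAction I _ X Y
  have h := congrArg (fun T : E →L[ℝ] ℝ => T Z) (hB.unique hconst)
  have h' : averagedInner I G X (⁅Z, Y⁆ : GroupLieAlgebra I G) +
      averagedInner I G (⁅Z, X⁆ : GroupLieAlgebra I G) Y = 0 := by
    rw [← fderiv_adjointAction, ← fderiv_adjointAction]
    simp only [hA1] at h
    exact h
  linarith

end InvariantInnerProduct

theorem mainTheorem3
    {E : Type*} [NormedAddCommGroup E] [NormedSpace ℝ E] [FiniteDimensional ℝ E]
    {H : Type*} [TopologicalSpace H] (I : ModelWithCorners ℝ E H) [I.Boundaryless]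
    (G : Type*) [Group G] [TopologicalSpace G] [ChartedSpace H G] [LieGroup I ∞ G]
    [CompactSpace G] [LieAlgebra.HasTrivialRadical ℝ (GroupLieAlgebra I G)]
    (D : LieDerivation ℝ (GroupLieAlgebra I G) (GroupLieAlgebra I G)) :
    (∀ μ : ℂ, (complexify D.toLinearMap).HasEigenvalue μ →
      IsSemisimpleEigenvalue (complexify D.toLinearMap) μ ∧ μ.re = 0) ∧
    (∃ (n : ℕ) (b : Module.Basis (Fin n) ℂ (ℂ ⊗[ℝ] GroupLieAlgebra I G)) (θ : Fin n → ℝ),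
      ∀ i, complexify D.toLinearMap (b i) = ((θ i : ℂ) * Complex.I) • b i) ∧
    (∀ (m : ℕ) (k : Fin m → ℕ) (μ : Fin m → ℂ)
      (b : Module.Basis (Σ i : Fin m, Fin (k i)) ℂ (ℂ ⊗[ℝ] GroupLieAlgebra I G)),
      IsJordanBasis (complexify D.toLinearMap) k μ b → ∀ i, k i = 1) := by
  have : FiniteDimensional ℝ (GroupLieAlgebra I G) := inferInstanceAs (FiniteDimensional ℝ E)
  obtain ⟨hss, hre⟩ := derivation_spectral_of_posDef_invariant (averagedCore I G)
    (averagedInner_bracket I) D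
  refine ⟨fun μ hμ => ⟨⟨hμ, hss.isFinitelySemisimple.maxGenEigenspace_eq_eigenspace μ⟩, hre μ hμ⟩,
    ?_, fun m k μ b hb i => hb.size_eq_one_of_isSemisimple hss i⟩
  obtain ⟨n, b, μ, hb⟩ := exists_basis_hasEigenvector_of_isSemisimple hss
  refine ⟨n, b, fun i => (μ i).im, fun i => ?_⟩
  have h0 := hre (μ i) (Module.End.hasEigenvalue_of_hasEigenvector (hb i))
  rw [(hb i).apply_eq_smul]
  congr 1
  simp [Complex.ext_iff, h0]
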